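/- Let $n\ge 2$. For $z\in\mathbb C\setminus\mathbb R$ let $R_0(z)=(-\Delta-z)^{-1}$ be the free resolvent on $L^2(\mathbb R^n)$, and let $e^{it\Delta}$, $t\in\mathbb R$, be the free Schrödinger propagator on $L^2(\mathbb R^n)$, i.e. $\widehat{e^{it\Delta}f}(\xi)=e^{-it|\xi|^2}\widehat f(\xi)$ with $\widehat f(\xi)=\int e^{-ix\cdot\xi}f(x)\,dx$. For a measurable $V:\mathbb R^n\to\mathbb C$ and $w=|V|$ or $w=|V|^{-1}$ (with $|V|^{-1}=\infty$ and $0\cdot\infty=0$ where $V=0$) put $$\|f\|_{L^2(w)}=\Big(\int_{\mathbb R^n}|f|^2w\,dx\Big)^{1/2},\qquad \|u\|_{L^2_{t,x}(w)}=\Big(\int_{\mathbb R}\int_{\mathbb R^n}|u(x,t)|^2w(x)\,dx\,dt\Big)^{1/2}.$$ There is a constant $C$, depending on $n$ only, such that the following holds. Let $V:\mathbb R^n\to\mathbb C$ be measurable and let $C(V)\ge 0$ be a constant such that $$\|R_0(z)f\|_{L^2(|V|)}\le C(V)\,\|f\|_{L^2(|V|^{-1})}$$ for all $z\in\mathbb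 C\setminus\mathbb R$ and all $f\in L^2(\mathbb R^n)\cap L^2(|V|^{-1})$. Then: (i) for every $f\in L^2(\mathbb R^n)$, $$\big\|e^{it\Delta}f\big\|_{L^2_{t,x}(|V|)}\le C\,C(V)^{1/2}\|f\|_{L^2(\mathbb R^n)};$$ (ii) for every measurable $F:\mathbb R^{n+1}\to\mathbb C$ in $L^2_{t,x}(|V|^{-1})$ and every $t\in\mathbb R$ the integral $\int_{-\infty}^\infty e^{i(t-s)\Delta}F(\cdot,s)\,ds$ exists as an element of $L^2(\mathbb R^n)$, and $$\bigg\|\int_{-\infty}^\infty e^{i(t-s)\Delta}F(\cdot,s)\,ds\bigg\|_{L^2_{t,x}(|V|)}\le C\,C(V)\,\|F\|_{L^2_{t,x}(|V|^{-1})}.$$ The integral in (ii) is understood weakly: it is the unique $g\in L^2(\mathbb R^n)$ such that, for every $h\in L^2(\mathbb R^n)$, $$\langle h,g\rangle=\int_{\mathbb R}\bigg(\int_{\mathbb R^n}\overline{e^{i(s-t)\Delta}h(x)}\,F(x,s)\,dx\bigg)ds,$$ where $\langle h,g\rangle=\int\overline h\,g\,dx$; here the inner integral is absolutely convergent for almost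 every $s$, and the outer one is absolutely convergent. -/

import Mathlib

open MeasureTheory FourierTransform ComplexConjugate
open scoped ENNReal NNReal Laplacian SchwartzMap TemperedDistribution

noncomputable section

namespace WeightedSchrodinger

/-- The Euclidean space `ℝⁿ`. -/
abbrev Space (n : ℕ) : Type := EuclideanSpace ℝ (Fin n)

/-- The Hilbert space `L²(ℝⁿ; ℂ)`. -/
abbrev L2 (n : ℕ) : Type := Lp ℂ 2 (volume : Measure (Space n))

variable {n : ℕ}

/-- The operator `f ↦ 𝓕⁻¹ (m 𝓕 f)` on `L²(ℝⁿ)` for a bounded symbol `m`. -/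
def fourierMultiplier (m : Space n → ℂ) (hm : MemLp m ∞ volume) (f : L2 n) : L2 n :=
  𝓕⁻ ((hm.toLp m) • (𝓕 f : L2 n) : L2 n)

/-- The symbol of `-Δ`. Since Mathlib's Fourier transform is
`𝓕 f (ξ) = ∫ exp (-2πi ⟨x, ξ⟩) f x dx`, this is `(2π|ξ|)²` and not `|ξ|²`. -/
def laplaceSymbol (ξ : Space n) : ℝ := (2 * Real.pi * ‖ξ‖) ^ 2

theorem memLp_resolventSymbol {z : ℂ} (hz : z.im ≠ 0) :
    MemLp (fun ξ : Space n => ((laplaceSymbol ξ : ℂ) - z)⁻¹) ∞ volume := by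
  have hne : ∀ ξ : Space n, (laplaceSymbol ξ : ℂ) - z ≠ 0 := fun ξ h => hz <| by
    simpa using congrArg Complex.im h
  refine memLp_top_of_bound (Continuous.aestronglyMeasurable ?_) |z.im|⁻¹ (.of_forall fun ξ => ?_)
  · refine Continuous.inv₀ ?_ hne
    unfold laplaceSymbol
    fun_prop
  · rw [norm_inv]
    refine inv_anti₀ (abs_pos.2 hz) ?_
    simpa using Complex.abs_im_le_norm ((laplaceSymbol ξ : ℂ) - z)

theorem memLp_propagatorSymbol (t : ℝ) :
    MemLp (fun ξ : Space n => Complex.exp (-(Complex.I * t * laplaceSymbol ξ))) ∞ volume := by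
  refine memLp_top_of_bound (Continuous.aestronglyMeasurable ?_) 1 (.of_forall fun ξ => ?_)
  · unfold laplaceSymbol
    fun_prop
  · simp [Complex.norm_exp]

/-- The free resolvent `R₀(z) = (-Δ - z)⁻¹` on `L²(ℝⁿ)`, for `z ∈ ℂ \ ℝ`. -/
def freeResolvent (z : ℂ) (hz : z.im ≠ 0) (f : L2 n) : L2 n :=
  fourierMultiplier _ (memLp_resolventSymbol hz) f

/-- The free Schrödinger propagator `e^{itΔ}` on `L²(ℝⁿ)`, the Fourier multiplier with symbol
`exp (-i t (2π|ξ|)²)`. -/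
def propagator (t : ℝ) (f : L2 n) : L2 n :=
  fourierMultiplier _ (memLp_propagatorSymbol t) f

/-- The norm of `L²(w) = L²(ℝⁿ; w dx)`, with value `∞` outside that space. -/
def weightedNorm (w : Space n → ℝ≥0∞) (f : Space n → ℂ) : ℝ≥0∞ :=
  (∫⁻ x, ‖f x‖ₑ ^ 2 * w x) ^ (1 / 2 : ℝ)

/-- The norm of `L²_{t,x}(w) = L²(ℝ × ℝⁿ; w(x) dt dx)`, with value `∞` outside that space. Written
as an iterated integral, it makes sense for curves `t ↦ u t` in `L²(ℝⁿ)`, too. -/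
def spaceTimeNorm (w : Space n → ℝ≥0∞) (u : ℝ → Space n → ℂ) : ℝ≥0∞ :=
  (∫⁻ t, ∫⁻ x, ‖u t x‖ₑ ^ 2 * w x) ^ (1 / 2 : ℝ)

/-- The weight `|V|`. -/
def absWeight (V : Space n → ℂ) (x : Space n) : ℝ≥0∞ := ‖V x‖ₑ

/-- The weight `|V|⁻¹`; it is `∞` where `V` vanishes. As `0 * ∞ = 0` in `ℝ≥0∞`, a function in
`L²(|V|⁻¹)` has to vanish almost everywhere on the zero set of `V`. -/
def invWeight (V : Space n → ℂ) (x : Space n) : ℝ≥0∞ := ‖V x‖ₑ⁻¹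

/-- The resolvent estimate `‖R₀(z) f‖_{L²(|V|)} ≤ A ‖f‖_{L²(|V|⁻¹)}`, uniformly in `z ∈ ℂ \ ℝ`,
for all those `f ∈ L²(|V|⁻¹)` to which the operator `R₀(z)` of `L²(ℝⁿ)` can be applied. -/
def ResolventEstimate (V : Space n → ℂ) (A : ℝ≥0) : Prop :=
  ∀ (z : ℂ) (hz : z.im ≠ 0) (f : L2 n), weightedNorm (invWeight V) f < ∞ →
    weightedNorm (absWeight V) (freeResolvent z hz f) ≤ A * weightedNorm (invWeight V) f

/-- `g = ∫ e^{i(t-s)Δ} F(·,s) ds` as an element of `L²(ℝⁿ)`. The integral is the weak one: as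
`e^{i(s-t)Δ}` is the adjoint of `e^{i(t-s)Δ}`, it is required that
`⟨h, g⟩ = ∫ ⟨e^{i(s-t)Δ} h, F(·,s)⟩ ds` for all `h ∈ L²(ℝⁿ)`, where
`⟨h, k⟩ = ∫ conj (h x) * k x dx`. This does not presuppose that `F(·,s)` lies in `L²(ℝⁿ)`. -/
def IsPropagatorIntegral (F : ℝ → Space n → ℂ) (t : ℝ) (g : L2 n) : Prop :=
  ∀ h : L2 n,
    (∀ᵐ s : ℝ, Integrable fun x => conj (propagator (s - t) h x) * F s x) ∧
    (Integrable fun s : ℝ => ∫ x, conj (propagator (s - t) h x) * F s x) ∧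
    inner ℂ h g = ∫ s : ℝ, ∫ x, conj (propagator (s - t) h x) * F s x

/-- The weak integral is unique. -/
theorem IsPropagatorIntegral.unique {F : ℝ → Space n → ℂ} {t : ℝ} {g g' : L2 n}
    (hg : IsPropagatorIntegral F t g) (hg' : IsPropagatorIntegral F t g') : g = g' :=
  ext_inner_left ℂ fun h => by rw [(hg h).2.2, (hg' h).2.2]

theorem inner_propagator_left (t : ℝ) (f g : L2 n) :
    inner ℂ (propagator (-t) f) g = inner ℂ f (propagator t g) := by
  rw [← Lp.inner_fourier_eq (propagator (-t) f), ← Lp.inner_fourier_eq f]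
  simp only [propagator, fourierMultiplier, FourierTransform.fourier_fourierInv_eq]
  rw [L2.inner_def, L2.inner_def]
  refine integral_congr_ae ?_
  filter_upwards [Lp.coeFn_lpSMul (r := 2) ((memLp_propagatorSymbol (n := n) (-t)).toLp _) (𝓕 f),
    Lp.coeFn_lpSMul (r := 2) ((memLp_propagatorSymbol (n := n) t).toLp _) (𝓕 g),
    (memLp_propagatorSymbol (n := n) (-t)).coeFn_toLp,
    (memLp_propagatorSymbol (n := n) t).coeFn_toLp] with ξ h1 h2 h3 h4
  rw [h1, h2]
  simp only [Pi.smul_apply', h3, h4, smul_eq_mul, RCLike.inner_apply, map_mul, ← Complex.exp_conj]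
  simp
  ring

/-- Where the Bochner integral of `s ↦ e^{i(t-s)Δ} F(·,s)` in `L²(ℝⁿ)` exists, it is the weak
integral. -/
theorem isPropagatorIntegral_integral {F : ℝ → Space n → ℂ} {t : ℝ} (Φ : ℝ → L2 n)
    (hF : ∀ᵐ s, F s =ᵐ[volume] Φ s) (hΦ : Integrable fun s => propagator (t - s) (Φ s)) :
    IsPropagatorIntegral F t (∫ s, propagator (t - s) (Φ s)) := by
  intro h
  have key : ∀ᵐ s : ℝ, ∫ x, conj (propagator (s - t) h x) * F s x =
      inner ℂ h (propagator (t - s) (Φ s)) := by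
    filter_upwards [hF] with s hs
    rw [← inner_propagator_left, neg_sub, L2.inner_def]
    refine integral_congr_ae ?_
    filter_upwards [hs] with x hx
    simp [hx, mul_comm]
  refine ⟨?_, ?_, ?_⟩
  · filter_upwards [hF] with s hs
    refine (L2.integrable_inner (𝕜 := ℂ) (propagator (s - t) h) (Φ s)).congr ?_
    filter_upwards [hs] with x hx
    simp [hx, mul_comm]
  · exact (hΦ.const_inner h).congr (key.mono fun s hs => hs.symm)
  · rw [integral_congr_ae key, integral_inner hΦ]

/-- `R₀(z) f` solves `-Δ u - z u = f` in the sense of tempered distributions. -/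
theorem freeResolvent_spec (z : ℂ) (hz : z.im ≠ 0) (f : L2 n) :
    -Δ (freeResolvent z hz f : 𝓢'(Space n, ℂ)) - z • (freeResolvent z hz f : 𝓢'(Space n, ℂ)) =
      (f : 𝓢'(Space n, ℂ)) := by
  set T : L2 n := ((memLp_resolventSymbol (n := n) hz).toLp _ • (𝓕 f : L2 n) : L2 n) with hT
  have hu : (freeResolvent z hz f : 𝓢'(Space n, ℂ)) = 𝓕⁻ (T : 𝓢'(Space n, ℂ)) :=
    (Lp.fourierInv_toTemperedDistribution_eq T).symm
  have hf : (f : 𝓢'(Space n, ℂ)) = 𝓕⁻ ((𝓕 f : L2 n) : 𝓢'(Space n, ℂ)) := by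
    rw [Lp.fourierInv_toTemperedDistribution_eq, FourierTransform.fourierInv_fourier_eq]
  have hgrowth : (fun ξ : Space n => Complex.ofReal (‖ξ‖ ^ 2)).HasTemperateGrowth := by fun_prop
  have key : (2 * Real.pi) ^ 2 • TemperedDistribution.smulLeftCLM ℂ
      (fun ξ : Space n => Complex.ofReal (‖ξ‖ ^ 2)) (T : 𝓢'(Space n, ℂ)) -
      z • (T : 𝓢'(Space n, ℂ)) = ((𝓕 f : L2 n) : 𝓢'(Space n, ℂ)) := by
    ext φ
    have e1 : ((2 * Real.pi) ^ 2 • TemperedDistribution.smulLeftCLM ℂ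
        (fun ξ : Space n => Complex.ofReal (‖ξ‖ ^ 2)) (T : 𝓢'(Space n, ℂ)) -
        z • (T : 𝓢'(Space n, ℂ))) φ =
        (T : 𝓢'(Space n, ℂ)) ((((2 * Real.pi) ^ 2 : ℝ) : ℂ) • SchwartzMap.smulLeftCLM ℂ
          (fun ξ : Space n => Complex.ofReal (‖ξ‖ ^ 2)) φ - z • φ) := by
      rw [map_sub, map_smul, map_smul]
      rfl
    rw [e1, Lp.toTemperedDistribution_apply, Lp.toTemperedDistribution_apply]
    refine integral_congr_ae ?_
    filter_upwards [Lp.coeFn_lpSMul (r := 2) ((memLp_resolventSymbol (n := n) hz).toLp _) (𝓕 f),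
      (memLp_resolventSymbol (n := n) hz).coeFn_toLp] with ξ h1 h2
    have hne : (laplaceSymbol ξ : ℂ) - z ≠ 0 := fun h => hz <| by
      simpa using congrArg Complex.im h
    rw [hT, h1]
    simp only [Pi.smul_apply', h2, smul_eq_mul, sub_apply, smul_apply,
      SchwartzMap.smulLeftCLM_apply_apply hgrowth]
    have e2 : (((2 * Real.pi) ^ 2 : ℝ) : ℂ) * (((‖ξ‖ ^ 2 : ℝ) : ℂ) * φ ξ) - z * φ ξ =
        ((laplaceSymbol ξ : ℂ) - z) * φ ξ := by
      simp only [laplaceSymbol, mul_pow]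
      push_cast
      ring
    rw [e2]
    field_simp
  rw [hu, hf, ← key, TemperedDistribution.laplacian_eq_fourierMultiplierCLM,
    TemperedDistribution.fourierMultiplierCLM_apply, FourierTransform.fourier_fourierInv_eq]
  have e3 : ∀ X Y : 𝓢'(Space n, ℂ), 𝓕⁻ ((2 * Real.pi) ^ 2 • X - z • Y) =
      (2 * Real.pi) ^ 2 • 𝓕⁻ X - z • 𝓕⁻ Y := by
    intro X Y
    have e4 : 𝓕⁻ ((2 * Real.pi) ^ 2 • X) = (2 * Real.pi) ^ 2 • 𝓕⁻ X := rfl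
    rw [← e4]
    simpa using (fourierInvCLM ℂ 𝓢'(Space n, ℂ)).map_sub ((2 * Real.pi) ^ 2 • X) (z • Y)
  rw [e3, neg_smul, neg_neg]

end WeightedSchrodinger

end

open WeightedSchrodinger

noncomputable section

namespace WeightedSchrodinger

variable {n : ℕ}

/-! This is Kato smoothing followed by a `T T*` argument. The square root of `|V|` may be unbounded,
so `B` is taken to be multiplication by `√(min |V| k)`, a bounded self-adjoint operator. The
hypothesis gives `‖B R₀(z) B‖ ≤ A` with no dependence on `z` or `k`. Pairing `R₀(z) - R₀(z̄) = 2i Im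
z R₀(z̄) R₀(z)` with `B g` turns this into `|Im z| ‖R₀(z) B g‖² ≤ A ‖g‖²`, and duality into `|Im z|
‖B R₀(z) u‖² ≤ A ‖u‖²` (`norm_apply_freeResolvent_sq_le`).

The Fourier transform in time of `e^{-ε|t|} e^{itΔ} f` is `2ε R₀(z̄) R₀(z) f` with `z = -2πτ + iε`
(`integral_exp_smul_propagator`). By Plancherel in `L²(ℝ; L²(ℝⁿ))`, the damped integral of `‖B
e^{itΔ} f‖²` is at most `4εA ∫ ‖R₀(z) f‖² dτ`. The last integral equals `‖f‖² / (2ε)`, so the bound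
is `2A ‖f‖²`, free of `ε` and `k`. Fatou for `ε → 0` and monotone convergence for `k → ∞` give the
homogeneous estimate, with constant `(2A)^{1/2}`.

For the second estimate, the pairing of `e^{isΔ} h` with `F` is a bounded conjugate-linear
functional of `h`, by the first estimate and Cauchy–Schwarz. Riesz represents it by some `g` with
`‖g‖ ≤ (2A)^{1/2} ‖F‖` (`exists_inner_eq_integral_propagator`). The weak integral at time `t` is
`e^{itΔ} g`, and the first estimate applied to `g` gives the constant `2A`. -/

/-! ### Multiplication operators and Fourier multipliers on `L²` -/

/-- Multiplication by a bounded function, as an operator on `L²(ℝⁿ)`. -/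
def mulOp (m : Space n → ℂ) (hm : MemLp m ∞ volume) : L2 n →L[ℂ] L2 n :=
  LinearMap.mkContinuous
    { toFun := fun f => (hm.toLp m • f : L2 n)
      map_add' := fun f g => Lp.add_smul (hm.toLp m) f g
      map_smul' := fun c f => (Lp.smul_comm c (hm.toLp m) f).symm } ‖hm.toLp m‖
    fun f => Lp.norm_smul_le (hm.toLp m) f

theorem coeFn_mulOp (m : Space n → ℂ) (hm : MemLp m ∞ volume) (f : L2 n) :
    mulOp m hm f =ᵐ[volume] fun x => m x * f x := by
  filter_upwards [Lp.coeFn_lpSMul (r := 2) (hm.toLp m) f, hm.coeFn_toLp] with x h1 h2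
  change (hm.toLp m • f : L2 n) x = _
  rw [h1, Pi.smul_apply', h2, smul_eq_mul]

theorem enorm_sq_eq_lintegral (f : L2 n) : ‖f‖ₑ ^ 2 = ∫⁻ x, ‖f x‖ₑ ^ 2 := by
  rw [Lp.enorm_def, eLpNorm_eq_lintegral_rpow_enorm_toReal (by simp) (by simp),
    ← ENNReal.rpow_natCast, ← ENNReal.rpow_mul]
  simp

theorem enorm_mulOp_sq (m : Space n → ℂ) (hm : MemLp m ∞ volume) (f : L2 n) :
    ‖mulOp m hm f‖ₑ ^ 2 = ∫⁻ x, ‖f x‖ₑ ^ 2 * ‖m x‖ₑ ^ 2 := by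
  rw [enorm_sq_eq_lintegral]
  refine lintegral_congr_ae ?_
  filter_upwards [coeFn_mulOp m hm f] with x hx
  rw [hx, enorm_mul, mul_pow, mul_comm]

theorem fourier_fourierMultiplier (m : Space n → ℂ) (hm : MemLp m ∞ volume) (f : L2 n) :
    (𝓕 (fourierMultiplier m hm f) : L2 n) =ᵐ[volume] fun ξ => m ξ * (𝓕 f : L2 n) ξ := by
  rw [fourierMultiplier, FourierTransform.fourier_fourierInv_eq]
  exact coeFn_mulOp m hm (𝓕 f)

theorem ext_fourier {f g : L2 n} (h : (𝓕 f : L2 n) =ᵐ[volume] (𝓕 g : L2 n)) : f = g :=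
  (Lp.fourierTransformₗᵢ (Space n) ℂ).injective (Lp.ext h)

theorem inner_eq_integral_fourier (f g : L2 n) :
    inner ℂ f g = ∫ ξ, conj ((𝓕 f : L2 n) ξ) * (𝓕 g : L2 n) ξ := by
  rw [← Lp.inner_fourier_eq, L2.inner_def]
  exact integral_congr_ae (.of_forall fun ξ => mul_comm _ _)

theorem enorm_fourierMultiplier_sq (m : Space n → ℂ) (hm : MemLp m ∞ volume) (f : L2 n) :
    ‖fourierMultiplier m hm f‖ₑ ^ 2 = ∫⁻ ξ, ‖(𝓕 f : L2 n) ξ‖ₑ ^ 2 * ‖m ξ‖ₑ ^ 2 := by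
  have h : ‖fourierMultiplier m hm f‖ₑ = ‖(𝓕 (fourierMultiplier m hm f) : L2 n)‖ₑ := by
    rw [← ofReal_norm, ← ofReal_norm, Lp.norm_fourier_eq]
  rw [h, fourierMultiplier, FourierTransform.fourier_fourierInv_eq]
  exact enorm_mulOp_sq m hm (𝓕 f)

/-- A Fourier multiplier as a continuous linear operator. -/
def fourierMultiplierL (m : Space n → ℂ) (hm : MemLp m ∞ volume) : L2 n →L[ℂ] L2 n :=
  (Lp.fourierTransformₗᵢ (Space n) ℂ).symm.toContinuousLinearEquiv.toContinuousLinearMap ∘L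
    mulOp m hm ∘L (Lp.fourierTransformₗᵢ (Space n) ℂ).toContinuousLinearEquiv.toContinuousLinearMap

theorem inner_mulOp_ofReal {m : Space n → ℝ} (hm : MemLp (fun x => (m x : ℂ)) ∞ volume)
    (f g : L2 n) : inner ℂ (mulOp _ hm f) g = inner ℂ f (mulOp _ hm g) := by
  rw [L2.inner_def, L2.inner_def]
  refine integral_congr_ae ?_
  filter_upwards [coeFn_mulOp _ hm f, coeFn_mulOp _ hm g] with x h1 h2
  simp [h1, h2]
  ring

/-! ### The resolvent -/

theorem laplaceSymbol_sub_ne_zero {z : ℂ} (hz : z.im ≠ 0) (ξ : Space n) :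
    (laplaceSymbol ξ : ℂ) - z ≠ 0 := fun h => hz <| by
  simpa using congrArg Complex.im h

theorem conj_im_ne_zero {z : ℂ} (hz : z.im ≠ 0) : (conj z).im ≠ 0 := by simpa using hz

theorem inner_freeResolvent_left {z : ℂ} (hz : z.im ≠ 0) (f g : L2 n) :
    inner ℂ (freeResolvent z hz f) g =
      inner ℂ f (freeResolvent (conj z) (conj_im_ne_zero hz) g) := by
  rw [inner_eq_integral_fourier, inner_eq_integral_fourier]
  refine integral_congr_ae ?_
  filter_upwards [fourier_fourierMultiplier _ (memLp_resolventSymbol hz) f,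
    fourier_fourierMultiplier _ (memLp_resolventSymbol (conj_im_ne_zero hz)) g] with ξ h1 h2
  rw [freeResolvent, freeResolvent, h1, h2]
  simp
  ring

/-- On the symbol side this is `(λ - z)⁻¹ - (λ - z̄)⁻¹ = (z - z̄) (λ - z̄)⁻¹ (λ - z)⁻¹`. -/
theorem freeResolvent_sub_freeResolvent_conj {z : ℂ} (hz : z.im ≠ 0) (f : L2 n) :
    freeResolvent z hz f - freeResolvent (conj z) (conj_im_ne_zero hz) f =
      (2 * z.im * Complex.I) •
        freeResolvent (conj z) (conj_im_ne_zero hz) (freeResolvent z hz f) := by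
  refine ext_fourier ?_
  have hsub : ∀ u v : L2 n, (𝓕 (u - v) : L2 n) = 𝓕 u - 𝓕 v :=
    map_sub (Lp.fourierTransformₗᵢ (Space n) ℂ)
  rw [FourierTransform.fourier_smul, hsub]
  filter_upwards [fourier_fourierMultiplier _ (memLp_resolventSymbol hz) f,
    fourier_fourierMultiplier _ (memLp_resolventSymbol (conj_im_ne_zero hz)) f,
    fourier_fourierMultiplier _ (memLp_resolventSymbol (conj_im_ne_zero hz))
      (freeResolvent z hz f),
    Lp.coeFn_sub (𝓕 (freeResolvent z hz f) : L2 n)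
      (𝓕 (freeResolvent (conj z) (conj_im_ne_zero hz) f)),
    Lp.coeFn_smul (2 * z.im * Complex.I)
      (𝓕 (freeResolvent (conj z) (conj_im_ne_zero hz) (freeResolvent z hz f)) : L2 n)]
    with ξ h1 h2 h3 h4 h5
  have e0 : 2 * (z.im : ℂ) * Complex.I = z - conj z := by
    rw [Complex.sub_conj]
    push_cast
    rfl
  rw [h4, h5, Pi.sub_apply, Pi.smul_apply]
  simp only [freeResolvent] at *
  rw [h1, h2, h3, h1, smul_eq_mul, e0]
  have e1 := laplaceSymbol_sub_ne_zero hz ξ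
  have e2 := laplaceSymbol_sub_ne_zero (conj_im_ne_zero hz) ξ
  field_simp
  ring

variable {B : L2 n →L[ℂ] L2 n} {A : ℝ}

/-- Boundedness of `B R₀(z) B` controls `R₀(z) B` through the imaginary part of the resolvent. -/
theorem norm_freeResolvent_apply_sq_le
    (hB : ∀ f g, inner ℂ (B f) g = inner ℂ f (B g))
    (hR : ∀ (z : ℂ) (hz : z.im ≠ 0) (g : L2 n), ‖B (freeResolvent z hz (B g))‖ ≤ A * ‖g‖)
    {z : ℂ} (hz : z.im ≠ 0) (g : L2 n) :
    |z.im| * ‖freeResolvent z hz (B g)‖ ^ 2 ≤ A * ‖g‖ ^ 2 := by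
  have bound : ∀ (w : ℂ) (hw : w.im ≠ 0),
      ‖inner ℂ (B g) (freeResolvent w hw (B g))‖ ≤ A * ‖g‖ ^ 2 := fun w hw => by
    rw [hB]
    calc _ ≤ ‖g‖ * ‖B (freeResolvent w hw (B g))‖ := norm_inner_le_norm _ _
      _ ≤ ‖g‖ * (A * ‖g‖) := by gcongr; exact hR w hw g
      _ = _ := by ring
  -- The resolvent identity paired with `B g`. Each term on the right is at most `A ‖g‖²`, and the
  -- two of them absorb the factor 2.
  have h1 : (2 * z.im * Complex.I) * ((‖freeResolvent z hz (B g)‖ ^ 2 : ℝ) : ℂ) =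
      inner ℂ (B g) (freeResolvent z hz (B g)) -
        inner ℂ (B g) (freeResolvent (conj z) (conj_im_ne_zero hz) (B g)) := by
    rw [← inner_sub_right, freeResolvent_sub_freeResolvent_conj hz, inner_smul_right,
      ← inner_freeResolvent_left hz, inner_self_eq_norm_sq_to_K]
    simp
  have h2 := congrArg norm h1
  have h3 := norm_sub_le (inner ℂ (B g) (freeResolvent z hz (B g)))
    (inner ℂ (B g) (freeResolvent (conj z) (conj_im_ne_zero hz) (B g)))
  rw [← h2] at h3
  have h4 : ‖(2 * z.im * Complex.I) * ((‖freeResolvent z hz (B g)‖ ^ 2 : ℝ) : ℂ)‖ =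
      2 * (|z.im| * ‖freeResolvent z hz (B g)‖ ^ 2) := by
    simp [mul_assoc]
  have := bound z hz
  have := bound _ (conj_im_ne_zero hz)
  linarith

/-- The bound dual to `norm_freeResolvent_apply_sq_le`. -/
theorem norm_apply_freeResolvent_sq_le (hA : 0 ≤ A)
    (hB : ∀ f g, inner ℂ (B f) g = inner ℂ f (B g))
    (hR : ∀ (z : ℂ) (hz : z.im ≠ 0) (g : L2 n), ‖B (freeResolvent z hz (B g))‖ ≤ A * ‖g‖)
    {z : ℂ} (hz : z.im ≠ 0) (u : L2 n) :
    |z.im| * ‖B (freeResolvent z hz u)‖ ^ 2 ≤ A * ‖u‖ ^ 2 := by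
  set v := B (freeResolvent z hz u) with hv
  set y := freeResolvent (conj z) (conj_im_ne_zero hz) (B v) with hy
  -- Duality by hand: `B` and `R₀(z)` are moved across the inner product, so that `⟨v, v⟩ = ⟨u, y⟩`
  -- and the previous bound applies to `y`.
  have h1 : ‖v‖ ^ 2 ≤ ‖u‖ * ‖y‖ := by
    calc ‖v‖ ^ 2 = ‖inner ℂ v v‖ := by simp
      _ = ‖inner ℂ u y‖ := by
        conv_lhs => rw [hv, hB, inner_freeResolvent_left]
      _ ≤ _ := norm_inner_le_norm _ _
  have h2 : |z.im| * ‖y‖ ^ 2 ≤ A * ‖v‖ ^ 2 := by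
    simpa using norm_freeResolvent_apply_sq_le hB hR (conj_im_ne_zero hz) v
  rcases (norm_nonneg v).eq_or_lt with h0 | h0
  · rw [← h0]
    simp only [ne_eq, OfNat.ofNat_ne_zero, not_false_eq_true, zero_pow, mul_zero]
    positivity
  · have h3 : (‖v‖ ^ 2) ^ 2 ≤ (‖u‖ * ‖y‖) ^ 2 := by gcongr
    have h4 : |z.im| * ‖v‖ ^ 2 * ‖v‖ ^ 2 ≤ A * ‖u‖ ^ 2 * ‖v‖ ^ 2 := by
      calc _ = |z.im| * (‖v‖ ^ 2) ^ 2 := by ring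
        _ ≤ |z.im| * (‖u‖ * ‖y‖) ^ 2 := by gcongr
        _ = ‖u‖ ^ 2 * (|z.im| * ‖y‖ ^ 2) := by ring
        _ ≤ ‖u‖ ^ 2 * (A * ‖v‖ ^ 2) := by gcongr
        _ = _ := by ring
    exact le_of_mul_le_mul_right h4 (by positivity)

/-! ### The propagator -/

theorem norm_propagatorSymbol (t a : ℝ) : ‖Complex.exp (-(Complex.I * t * a))‖ = 1 := by
  simp [Complex.norm_exp]

theorem norm_propagator (t : ℝ) (f : L2 n) : ‖propagator t f‖ = ‖f‖ := by
  have h : ‖propagator t f‖ₑ ^ 2 = ‖(𝓕 f : L2 n)‖ₑ ^ 2 := by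
    rw [propagator, enorm_fourierMultiplier_sq, enorm_sq_eq_lintegral]
    refine lintegral_congr fun ξ => ?_
    rw [← ofReal_norm (Complex.exp _), norm_propagatorSymbol]
    simp
  have h' := (ENNReal.pow_right_strictMono two_ne_zero).injective h
  rw [← ofReal_norm, ← ofReal_norm, Lp.norm_fourier_eq,
    ENNReal.ofReal_eq_ofReal_iff (norm_nonneg _) (norm_nonneg _)] at h'
  exact h'

theorem propagator_propagator (s t : ℝ) (f : L2 n) :
    propagator s (propagator t f) = propagator (s + t) f := by
  refine ext_fourier ?_
  filter_upwards [fourier_fourierMultiplier _ (memLp_propagatorSymbol s) (propagator t f),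
    fourier_fourierMultiplier _ (memLp_propagatorSymbol t) f,
    fourier_fourierMultiplier _ (memLp_propagatorSymbol (s + t)) f] with ξ h1 h2 h3
  simp only [propagator] at *
  rw [h1, h2, h3, ← mul_assoc, ← Complex.exp_add]
  congr 2
  push_cast
  ring

theorem integrable_conj_fourier_mul (f g : L2 n) :
    Integrable fun ξ => conj ((𝓕 f : L2 n) ξ) * (𝓕 g : L2 n) ξ := by
  simpa [mul_comm] using L2.integrable_inner (𝕜 := ℂ) (𝓕 f : L2 n) (𝓕 g)

theorem inner_propagator_right (t : ℝ) (f g : L2 n) :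
    inner ℂ f (propagator t g) = ∫ ξ, Complex.exp (-(Complex.I * t * laplaceSymbol ξ)) *
      (conj ((𝓕 f : L2 n) ξ) * (𝓕 g : L2 n) ξ) := by
  rw [inner_eq_integral_fourier]
  refine integral_congr_ae ?_
  filter_upwards [fourier_fourierMultiplier _ (memLp_propagatorSymbol t) g] with ξ h1
  rw [propagator, h1]
  ring

theorem continuous_laplaceSymbol : Continuous (laplaceSymbol (n := n)) := by
  unfold laplaceSymbol
  fun_prop

/-- Weak continuity follows from dominated convergence on the Fourier side; as the propagator is
isometric, weak continuity upgrades to strong continuity. -/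
theorem continuous_propagator (f : L2 n) : Continuous fun t => propagator t f := by
  have hw : ∀ g : L2 n, Continuous fun t => inner ℂ g (propagator t f) := fun g => by
    simp only [inner_propagator_right]
    refine continuous_of_dominated (bound := fun ξ => ‖conj ((𝓕 g : L2 n) ξ) * (𝓕 f : L2 n) ξ‖)
      (fun t => ?_) (fun t => .of_forall fun ξ => ?_) (integrable_conj_fourier_mul g f).norm
      (.of_forall fun ξ => by fun_prop)
    · exact ((memLp_propagatorSymbol t).aestronglyMeasurable).mul
        (integrable_conj_fourier_mul g f).aestronglyMeasurable
    · rw [norm_mul, norm_propagatorSymbol, one_mul]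
  refine continuous_iff_continuousAt.2 fun s => ?_
  have key : ∀ t, ‖propagator t f - propagator s f‖ ^ 2 =
      2 * ‖f‖ ^ 2 - 2 * RCLike.re (inner ℂ (propagator s f) (propagator t f)) := fun t => by
    rw [norm_sub_sq (𝕜 := ℂ), norm_propagator, norm_propagator, inner_re_symm]
    ring
  have h0 : Filter.Tendsto (fun t => ‖propagator t f - propagator s f‖ ^ 2) (nhds s) (nhds 0) := by
    simp only [key]
    have h2 : Continuous fun t => 2 * ‖f‖ ^ 2 -
        2 * RCLike.re (inner ℂ (propagator s f) (propagator t f)) := by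
      have := hw (propagator s f)
      fun_prop
    refine (h2.tendsto s).trans (le_of_eq ?_)
    rw [inner_self_eq_norm_sq (𝕜 := ℂ), norm_propagator, sub_self]
  refine tendsto_iff_norm_sub_tendsto_zero.2 ?_
  simpa using h0.sqrt

/-! ### Plancherel's theorem for Hilbert space valued functions -/

section Plancherel

variable {H : Type*} [NormedAddCommGroup H] [InnerProductSpace ℂ H] [CompleteSpace H]

/-- Both sides have the same integrals against smooth compactly supported functions, because the
Fourier transform can be moved onto the test function in either setting. This makes the abstract
`L²` Plancherel theorem available for the integral formula. -/
theorem fourier_toLp_ae_eq {Φ : ℝ → H} (h1 : Integrable Φ) (h2 : MemLp Φ 2 volume) :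
    (𝓕 (h2.toLp Φ) : Lp H 2 (volume : Measure ℝ)) =ᵐ[volume] 𝓕 Φ := by
  have hc : Continuous (𝓕 Φ) :=
    VectorFourier.fourierIntegral_continuous Real.continuous_fourierChar
      (L := innerₗ ℝ) continuous_inner h1
  refine ae_eq_of_integral_contDiff_smul_eq
    ((Lp.memLp _).locallyIntegrable (by norm_num)) hc.locallyIntegrable fun g hg hgc => ?_
  have hg' : ContDiff ℝ (⊤ : ℕ∞) (fun x => (g x : ℂ)) := Complex.ofRealCLM.contDiff.comp hg
  have hgc' : HasCompactSupport (fun x => (g x : ℂ)) := hgc.comp_left (g := Complex.ofReal) rfl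
  set φ : 𝓢(ℝ, ℂ) := hgc'.toSchwartzMap hg' with hφ
  have hφg : ∀ x, φ x = g x := fun x => rfl
  have e1 := congrArg (fun T : 𝓢'(ℝ, H) => T φ) (Lp.fourier_toTemperedDistribution_eq (h2.toLp Φ))
  simp only [TemperedDistribution.fourier_apply, Lp.toTemperedDistribution_apply] at e1
  have e2 : ∫ x, (𝓕 φ) x • (h2.toLp Φ) x = ∫ x, 𝓕 (φ : ℝ → ℂ) x • Φ x := by
    refine integral_congr_ae ?_
    filter_upwards [h2.coeFn_toLp] with x hx
    rw [hx, SchwartzMap.fourier_coe]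
  have e3 : ∫ x, 𝓕 (φ : ℝ → ℂ) x • Φ x = ∫ x, φ x • 𝓕 Φ x := by
    simpa using! (VectorFourier.integral_fourierIntegral_smul_eq_flip (L := innerₗ ℝ)
      Real.continuous_fourierChar continuous_inner φ.integrable h1)
  rw [e2, e3] at e1
  simp only [hφg, Complex.coe_smul] at e1
  exact e1.symm

theorem lintegral_enorm_fourier_sq {Φ : ℝ → H} (h1 : Integrable Φ) (h2 : MemLp Φ 2 volume) :
    ∫⁻ τ, ‖𝓕 Φ τ‖ₑ ^ 2 = ∫⁻ t, ‖Φ t‖ₑ ^ 2 := by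
  have key : ∀ f : Lp H 2 (volume : Measure ℝ), ‖f‖ₑ ^ 2 = ∫⁻ x, ‖f x‖ₑ ^ 2 := fun f => by
    rw [Lp.enorm_def, eLpNorm_eq_lintegral_rpow_enorm_toReal (by simp) (by simp),
      ← ENNReal.rpow_natCast, ← ENNReal.rpow_mul]
    simp
  have e1 : ∫⁻ τ, ‖𝓕 Φ τ‖ₑ ^ 2 = ‖𝓕 (h2.toLp Φ)‖ₑ ^ 2 := by
    rw [key]
    refine lintegral_congr_ae ?_
    filter_upwards [fourier_toLp_ae_eq h1 h2] with x hx
    rw [hx]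
  have e2 : ∫⁻ t, ‖Φ t‖ₑ ^ 2 = ‖h2.toLp Φ‖ₑ ^ 2 := by
    rw [key]
    refine lintegral_congr_ae ?_
    filter_upwards [h2.coeFn_toLp] with x hx
    rw [hx]
  rw [e1, e2, ← ofReal_norm, ← ofReal_norm, Lp.norm_fourier_eq]

end Plancherel

/-! ### The Fourier transform of the damped propagator -/

section Exp

variable {ε : ℝ}

theorem eqOn_exp_abs_Iic (ε x : ℝ) : Set.EqOn (fun t : ℝ => Complex.exp ((ε - Complex.I * x) * t))
    (fun t : ℝ => Complex.exp (-(ε * |t| : ℝ) - Complex.I * t * x)) (Set.Iic 0) := fun t ht => by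
  simp only [abs_of_nonpos (Set.mem_Iic.1 ht)]
  congr 1
  push_cast
  ring

theorem eqOn_exp_abs_Ioi (ε x : ℝ) : Set.EqOn (fun t : ℝ => Complex.exp ((-ε - Complex.I * x) * t))
    (fun t : ℝ => Complex.exp (-(ε * |t| : ℝ) - Complex.I * t * x)) (Set.Ioi 0) := fun t ht => by
  simp only [abs_of_pos (Set.mem_Ioi.1 ht)]
  congr 1
  push_cast
  ring

theorem integrable_exp_abs (hε : 0 < ε) (x : ℝ) :
    Integrable fun t : ℝ => Complex.exp (-(ε * |t| : ℝ) - Complex.I * t * x) := by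
  have h1 := (integrableOn_exp_mul_complex_Iic (a := ε - Complex.I * x) (by simpa) 0).congr_fun
    (eqOn_exp_abs_Iic ε x) measurableSet_Iic
  have h2 := (integrableOn_exp_mul_complex_Ioi (a := -ε - Complex.I * x) (by simpa) 0).congr_fun
    (eqOn_exp_abs_Ioi ε x) measurableSet_Ioi
  simpa [Set.Iic_union_Ioi] using h1.union h2

theorem integral_exp_abs (hε : 0 < ε) (x : ℝ) :
    ∫ t : ℝ, Complex.exp (-(ε * |t| : ℝ) - Complex.I * t * x) =
      2 * ε * ((x + Complex.I * ε)⁻¹ * (x - Complex.I * ε)⁻¹) := by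
  have hi := integrable_exp_abs hε x
  rw [← intervalIntegral.integral_Iic_add_Ioi (b := 0) hi.integrableOn hi.integrableOn,
    ← setIntegral_congr_fun measurableSet_Iic (eqOn_exp_abs_Iic ε x),
    ← setIntegral_congr_fun measurableSet_Ioi (eqOn_exp_abs_Ioi ε x),
    integral_exp_mul_complex_Iic (by simpa), integral_exp_mul_complex_Ioi (by simpa)]
  have e1 : (ε : ℂ) - Complex.I * x = -Complex.I * (x + Complex.I * ε) := by
    linear_combination (ε : ℂ) * Complex.I_sq
  have e2 : -(ε : ℂ) - Complex.I * x = -Complex.I * (x - Complex.I * ε) := by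
    linear_combination (-ε : ℂ) * Complex.I_sq
  have h3 : (x : ℂ) + Complex.I * ε ≠ 0 := fun h => hε.ne' (by simpa using congrArg Complex.im h)
  have h4 : (x : ℂ) - Complex.I * ε ≠ 0 := fun h => hε.ne' (by simpa using congrArg Complex.im h)
  simp only [Complex.ofReal_zero, mul_zero, Complex.exp_zero, e1, e2]
  field_simp
  ring

theorem integrable_exp_neg_mul_abs (hε : 0 < ε) :
    Integrable fun t : ℝ => Real.exp (-(ε * |t|)) := by
  refine (integrable_exp_abs hε 0).norm.congr (.of_forall fun t => ?_)
  simp [Complex.norm_exp]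

theorem lintegral_inv_add_sq (hε : 0 < ε) (x : ℝ) :
    ∫⁻ τ : ℝ, ENNReal.ofReal (((x + 2 * Real.pi * τ) ^ 2 + ε ^ 2)⁻¹) =
    ENNReal.ofReal (1 / (2 * ε)) := by
  have hc : 2 * Real.pi / ε ≠ 0 := by positivity
  have e : ∀ τ : ℝ, ((x + 2 * Real.pi * τ) ^ 2 + ε ^ 2)⁻¹ =
      (ε ^ 2)⁻¹ * (1 + (2 * Real.pi / ε * τ + x / ε) ^ 2)⁻¹ := fun τ => by
    rw [← mul_inv]
    congr 1
    field_simp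
    ring
  have hi : Integrable fun τ : ℝ => (1 + (2 * Real.pi / ε * τ + x / ε) ^ 2)⁻¹ :=
    (integrable_inv_one_add_sq.comp_add_right (x / ε)).comp_mul_left' hc
  simp only [e]
  rw [← ofReal_integral_eq_lintegral_ofReal (hi.const_mul _) (.of_forall fun τ => by positivity),
    integral_const_mul, Measure.integral_comp_mul_left (fun y => (1 + (y + x / ε) ^ 2)⁻¹),
    integral_add_right_eq_self (fun y : ℝ => (1 + y ^ 2)⁻¹), integral_univ_inv_one_add_sq,
    abs_of_pos (by positivity)]
  congr 1
  simp only [smul_eq_mul]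
  field_simp

end Exp

theorem integrable_exp_smul_propagator {ε : ℝ} (hε : 0 < ε) (y : ℝ) (f : L2 n) :
    Integrable fun t : ℝ =>
      Complex.exp (-(ε * |t| : ℝ) - Complex.I * t * y) • propagator t f := by
  refine (((integrable_exp_abs hε y).norm).mul_const ‖f‖).mono' ?_ (.of_forall fun t => ?_)
  · refine Continuous.aestronglyMeasurable ?_
    have := continuous_propagator f
    fun_prop
  · rw [norm_smul, norm_propagator]

/-- Tested against `h` and exchanged by Fubini, the time integral at frequency `ξ` is the transform
of `e^{-ε|t|}` at `laplaceSymbol ξ + y`, which factors as `2ε` times the two resolvent symbols. -/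
theorem integral_exp_smul_propagator {ε : ℝ} (hε : 0 < ε) (y : ℝ) {z : ℂ} (hz : z.im ≠ 0)
    (hzε : z = -y + Complex.I * ε) (f : L2 n) :
    ∫ t : ℝ, Complex.exp (-(ε * |t| : ℝ) - Complex.I * t * y) • propagator t f =
      (2 * ε : ℂ) • freeResolvent (conj z) (conj_im_ne_zero hz) (freeResolvent z hz f) := by
  refine ext_inner_left ℂ fun h => ?_
  rw [← integral_inner (integrable_exp_smul_propagator hε y f), inner_smul_right,
    inner_eq_integral_fourier]
  simp only [inner_smul_right, inner_propagator_right, ← integral_const_mul]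
  rw [integral_integral_swap]
  · refine integral_congr_ae ?_
    filter_upwards [fourier_fourierMultiplier _ (memLp_resolventSymbol hz) f,
      fourier_fourierMultiplier _ (memLp_resolventSymbol (conj_im_ne_zero hz))
        (freeResolvent z hz f)] with ξ h1 h2
    have e : ∀ t : ℝ, Complex.exp (-(ε * |t| : ℝ) - Complex.I * t * y) *
        (Complex.exp (-(Complex.I * t * laplaceSymbol ξ)) *
          (conj ((𝓕 h : L2 n) ξ) * (𝓕 f : L2 n) ξ)) =
        Complex.exp (-(ε * |t| : ℝ) - Complex.I * t * (laplaceSymbol ξ + y : ℝ)) *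
          (conj ((𝓕 h : L2 n) ξ) * (𝓕 f : L2 n) ξ) := fun t => by
      rw [← mul_assoc, ← Complex.exp_add]
      congr 2
      push_cast
      ring
    simp only [e, integral_mul_const, integral_exp_abs hε]
    simp only [freeResolvent] at h1 h2 ⊢
    rw [h2, h1, hzε]
    have e1 : (laplaceSymbol ξ : ℂ) - conj (-(y : ℂ) + Complex.I * ε) =
        (laplaceSymbol ξ + y : ℝ) + Complex.I * ε := by
      simp
      ring
    have e2 : (laplaceSymbol ξ : ℂ) - (-(y : ℂ) + Complex.I * ε) =
        (laplaceSymbol ξ + y : ℝ) - Complex.I * ε := by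
      push_cast
      ring
    rw [e1, e2]
    ring
  · refine (((integrable_exp_abs hε y).mul_prod (integrable_conj_fourier_mul h f))).mono ?_
      (.of_forall fun p => ?_)
    · refine AEStronglyMeasurable.mul (Continuous.aestronglyMeasurable (by fun_prop))
        (AEStronglyMeasurable.mul (Continuous.aestronglyMeasurable ?_) ?_)
      · have := continuous_laplaceSymbol (n := n)
        fun_prop
      · exact (integrable_conj_fourier_mul h f).aestronglyMeasurable.comp_snd
    · simp only [Function.uncurry, norm_mul, norm_propagatorSymbol, one_mul]
      rfl

/-- By Plancherel in `x` and Tonelli, only the `τ`-integral of `|λ - z τ|⁻²` is needed; it does not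
depend on `λ`. -/
theorem lintegral_enorm_freeResolvent_sq {ε : ℝ} (hε : 0 < ε) (f : L2 n) {z : ℝ → ℂ}
    (hz : ∀ τ, (z τ).im ≠ 0) (hzε : ∀ τ, z τ = -(2 * Real.pi * τ : ℝ) + Complex.I * ε) :
    ∫⁻ τ, ‖freeResolvent (z τ) (hz τ) f‖ₑ ^ 2 = ENNReal.ofReal (1 / (2 * ε)) * ‖f‖ₑ ^ 2 := by
  have e : ∀ (τ : ℝ) (ξ : Space n), ‖((laplaceSymbol ξ : ℂ) - z τ)⁻¹‖ₑ ^ 2 =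
      ENNReal.ofReal (((laplaceSymbol ξ + 2 * Real.pi * τ) ^ 2 + ε ^ 2)⁻¹) := fun τ ξ => by
    rw [← ofReal_norm, ← ENNReal.ofReal_pow (norm_nonneg _), norm_inv, inv_pow,
      ← Complex.normSq_eq_norm_sq, hzε, Complex.normSq_apply]
    congr 2
    simp
    ring
  have hf : ‖f‖ₑ = ‖(𝓕 f : L2 n)‖ₑ := by rw [← ofReal_norm, ← ofReal_norm, Lp.norm_fourier_eq]
  simp only [freeResolvent, enorm_fourierMultiplier_sq, e]
  rw [lintegral_lintegral_swap]
  · rw [hf, enorm_sq_eq_lintegral, ← lintegral_const_mul' _ _ ENNReal.ofReal_ne_top]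
    refine lintegral_congr fun ξ => ?_
    rw [lintegral_const_mul' _ _ (by finiteness), lintegral_inv_add_sq hε, mul_comm]
  · have h1 : AEMeasurable (fun p : ℝ × Space n => ‖(𝓕 f : L2 n) p.2‖ₑ ^ 2)
        (volume.prod volume) :=
      ((Lp.aestronglyMeasurable (𝓕 f : L2 n)).enorm.pow_const 2).comp_snd
    have h2 : Continuous fun p : ℝ × Space n =>
        ENNReal.ofReal (((laplaceSymbol p.2 + 2 * Real.pi * p.1) ^ 2 + ε ^ 2)⁻¹) := by
      refine ENNReal.continuous_ofReal.comp (Continuous.inv₀ ?_ fun p => by positivity)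
      have := continuous_laplaceSymbol (n := n)
      fun_prop
    exact h1.mul h2.aemeasurable

/-! ### Kato smoothing for a bounded self-adjoint factor -/

variable {B : L2 n →L[ℂ] L2 n} {A : ℝ}

/-- The smoothing estimate with an exponential damping in time. -/
theorem lintegral_exp_mul_enorm_apply_propagator_sq_le (hA : 0 ≤ A)
    (hB : ∀ f g, inner ℂ (B f) g = inner ℂ f (B g))
    (hR : ∀ (z : ℂ) (hz : z.im ≠ 0) (g : L2 n), ‖B (freeResolvent z hz (B g))‖ ≤ A * ‖g‖)
    {ε : ℝ} (hε : 0 < ε) (f : L2 n) :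
    ∫⁻ t : ℝ, ENNReal.ofReal (Real.exp (-(ε * |t|))) ^ 2 * ‖B (propagator t f)‖ₑ ^ 2 ≤
      ENNReal.ofReal (2 * A) * ‖f‖ₑ ^ 2 := by
  set Φ : ℝ → L2 n := fun t => (Real.exp (-(ε * |t|)) : ℂ) • B (propagator t f) with hΦ
  have hcont : Continuous Φ := by
    have := continuous_propagator f
    fun_prop
  have hbound : ∀ t, ‖Φ t‖ ≤ Real.exp (-(ε * |t|)) * (‖B‖ * ‖f‖) := fun t => by
    rw [hΦ, norm_smul, Complex.norm_real, Real.norm_of_nonneg (Real.exp_pos _).le]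
    gcongr
    exact (B.le_opNorm _).trans_eq (by rw [norm_propagator])
  have h1 : Integrable Φ :=
    ((integrable_exp_neg_mul_abs hε).mul_const _).mono' hcont.aestronglyMeasurable
      (.of_forall hbound)
  have h2 : MemLp Φ 2 volume := by
    refine (memLp_two_iff_integrable_sq_norm hcont.aestronglyMeasurable).2 ?_
    refine ((integrable_exp_neg_mul_abs hε).mul_const ((‖B‖ * ‖f‖) ^ 2)).mono'
      (hcont.norm.pow 2).aestronglyMeasurable (.of_forall fun t => ?_)
    rw [Real.norm_of_nonneg (by positivity)]
    have h3 : Real.exp (-(ε * |t|)) ≤ 1 := Real.exp_le_one_iff.2 (by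
      have := abs_nonneg t
      nlinarith)
    have h4 := (Real.exp_pos (-(ε * |t|))).le
    calc ‖Φ t‖ ^ 2 ≤ (Real.exp (-(ε * |t|)) * (‖B‖ * ‖f‖)) ^ 2 := by gcongr; exact hbound t
      _ = Real.exp (-(ε * |t|)) * Real.exp (-(ε * |t|)) * (‖B‖ * ‖f‖) ^ 2 := by ring
      _ ≤ Real.exp (-(ε * |t|)) * 1 * (‖B‖ * ‖f‖) ^ 2 := by gcongr
      _ = _ := by ring
  -- The frequency `τ` carries the phase `exp (-2πi t τ)`, hence the real part `-2πτ`.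
  set z : ℝ → ℂ := fun τ => -(2 * Real.pi * τ : ℝ) + Complex.I * ε with hzdef
  have him : ∀ τ, (z τ).im = ε := fun τ => by simp [hzdef]
  have hz : ∀ τ, (z τ).im ≠ 0 := fun τ => by rw [him]; exact hε.ne'
  have hF : ∀ τ, 𝓕 Φ τ = B ((2 * ε : ℂ) •
      freeResolvent (conj (z τ)) (conj_im_ne_zero (hz τ)) (freeResolvent (z τ) (hz τ) f)) := by
    intro τ
    rw [← integral_exp_smul_propagator hε (2 * Real.pi * τ) (hz τ) rfl,
      ← B.integral_comp_comm (integrable_exp_smul_propagator hε _ f),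
      Real.fourier_real_eq_integral_exp_smul]
    refine integral_congr_ae (.of_forall fun t => ?_)
    simp only [hΦ, map_smul, smul_smul]
    rw [Complex.ofReal_exp, ← Complex.exp_add]
    congr 2
    push_cast
    ring
  have hest : ∀ τ, ‖𝓕 Φ τ‖ₑ ^ 2 ≤
      ENNReal.ofReal (4 * ε * A) * ‖freeResolvent (z τ) (hz τ) f‖ₑ ^ 2 := fun τ => by
    -- One of the two resolvents is spent on `B`: this gains `A / ε` against the factor `(2ε)²`. The
    -- other one is kept for the integration in `τ`.
    have h5 := norm_apply_freeResolvent_sq_le hA hB hR (conj_im_ne_zero (hz τ))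
      (freeResolvent (z τ) (hz τ) f)
    rw [Complex.conj_im, abs_neg, him, abs_of_pos hε] at h5
    rw [hF, map_smul, ← ofReal_norm, ← ofReal_norm, ← ENNReal.ofReal_pow (norm_nonneg _),
      ← ENNReal.ofReal_pow (norm_nonneg _), ← ENNReal.ofReal_mul (by positivity)]
    refine ENNReal.ofReal_le_ofReal ?_
    rw [norm_smul, mul_pow]
    have h6 : ‖(2 * ε : ℂ)‖ = 2 * ε := by simp [abs_of_pos hε]
    rw [h6]
    nlinarith
  calc ∫⁻ t : ℝ, ENNReal.ofReal (Real.exp (-(ε * |t|))) ^ 2 * ‖B (propagator t f)‖ₑ ^ 2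
      = ∫⁻ t, ‖Φ t‖ₑ ^ 2 := by
        refine lintegral_congr fun t => ?_
        rw [hΦ, enorm_smul, mul_pow, ← ofReal_norm (Real.exp _ : ℂ), Complex.norm_real,
          Real.norm_of_nonneg (Real.exp_pos _).le]
    _ = ∫⁻ τ, ‖𝓕 Φ τ‖ₑ ^ 2 := (lintegral_enorm_fourier_sq h1 h2).symm
    _ ≤ ∫⁻ τ, ENNReal.ofReal (4 * ε * A) * ‖freeResolvent (z τ) (hz τ) f‖ₑ ^ 2 :=
        lintegral_mono hest
    _ = ENNReal.ofReal (2 * A) * ‖f‖ₑ ^ 2 := by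
        rw [lintegral_const_mul' _ _ ENNReal.ofReal_ne_top,
          lintegral_enorm_freeResolvent_sq hε f hz fun τ => rfl, ← mul_assoc,
          ← ENNReal.ofReal_mul (by positivity)]
        congr 2
        field_simp
        ring

/-- **Kato smoothing**: a bound for `B R₀(z) B`, uniform in `z`, gives a space-time bound. -/
theorem lintegral_enorm_apply_propagator_sq_le (hA : 0 ≤ A)
    (hB : ∀ f g, inner ℂ (B f) g = inner ℂ f (B g))
    (hR : ∀ (z : ℂ) (hz : z.im ≠ 0) (g : L2 n), ‖B (freeResolvent z hz (B g))‖ ≤ A * ‖g‖)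
    (f : L2 n) :
    ∫⁻ t : ℝ, ‖B (propagator t f)‖ₑ ^ 2 ≤ ENNReal.ofReal (2 * A) * ‖f‖ₑ ^ 2 := by
  have hmeas : Measurable fun t => ‖B (propagator t f)‖ₑ ^ 2 := by
    have := continuous_propagator f
    refine Measurable.pow_const (Continuous.measurable ?_) 2
    exact (by fun_prop : Continuous fun t => B (propagator t f)).enorm
  -- The damping is removed along `ε = 1 / (k + 1)`; Fatou's lemma suffices, as the damped bound
  -- does not depend on `ε`.
  have hlim : ∀ t : ℝ, Filter.Tendsto (fun k : ℕ =>
      ENNReal.ofReal (Real.exp (-(1 / ((k : ℝ) + 1) * |t|))) ^ 2 * ‖B (propagator t f)‖ₑ ^ 2)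
      Filter.atTop (nhds (‖B (propagator t f)‖ₑ ^ 2)) := fun t => by
    have h1 : Filter.Tendsto (fun k : ℕ => Real.exp (-(1 / ((k : ℝ) + 1) * |t|))) Filter.atTop
        (nhds 1) := by
      have := ((tendsto_one_div_add_atTop_nhds_zero_nat (𝕜 := ℝ)).mul_const |t|).neg.rexp
      simpa using this
    have h2 := ENNReal.Tendsto.pow (n := 2) (ENNReal.tendsto_ofReal h1)
    simpa using ENNReal.Tendsto.mul_const h2 (b := ‖B (propagator t f)‖ₑ ^ 2)
      (.inr (by finiteness))
  calc ∫⁻ t : ℝ, ‖B (propagator t f)‖ₑ ^ 2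
      = ∫⁻ t : ℝ, Filter.liminf (fun k : ℕ =>
          ENNReal.ofReal (Real.exp (-(1 / ((k : ℝ) + 1) * |t|))) ^ 2 *
            ‖B (propagator t f)‖ₑ ^ 2) Filter.atTop :=
        lintegral_congr fun t => (hlim t).liminf_eq.symm
    _ ≤ Filter.liminf (fun k : ℕ => ∫⁻ t : ℝ,
          ENNReal.ofReal (Real.exp (-(1 / ((k : ℝ) + 1) * |t|))) ^ 2 *
            ‖B (propagator t f)‖ₑ ^ 2) Filter.atTop :=
        lintegral_liminf_le fun k => by fun_prop
    _ ≤ _ := by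
        refine Filter.liminf_le_of_le (by isBoundedDefault) fun b hb => ?_
        obtain ⟨k, hk⟩ := hb.exists
        exact hk.trans (lintegral_exp_mul_enorm_apply_propagator_sq_le hA hB hR
          (by positivity) f)

/-! ### The homogeneous estimate -/

/-- The square root of the truncated weight `min |V| k`. -/
def sqrtWeight (V : Space n → ℂ) (k : ℕ) (x : Space n) : ℝ := √(min ‖V x‖ k)

theorem memLp_sqrtWeight {V : Space n → ℂ} (hV : AEMeasurable V volume) (k : ℕ) :
    MemLp (fun x => (sqrtWeight V k x : ℂ)) ∞ volume := by
  refine memLp_top_of_bound (AEMeasurable.aestronglyMeasurable ?_) √k (.of_forall fun x => ?_)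
  · unfold sqrtWeight
    exact Complex.measurable_ofReal.comp_aemeasurable
      (hV.norm.min aemeasurable_const).sqrt
  · rw [Complex.norm_real, sqrtWeight, Real.norm_of_nonneg (Real.sqrt_nonneg _)]
    exact Real.sqrt_le_sqrt (min_le_right _ _)

theorem enorm_sqrtWeight_sq (V : Space n → ℂ) (k : ℕ) (x : Space n) :
    ‖(sqrtWeight V k x : ℂ)‖ₑ ^ 2 = min ‖V x‖ₑ k := by
  rw [← ofReal_norm, ← ofReal_norm, ← ENNReal.ofReal_pow (norm_nonneg _), Complex.norm_real,
    sqrtWeight, Real.norm_of_nonneg (Real.sqrt_nonneg _), Real.sq_sqrt (by positivity),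
    ENNReal.ofReal_min, ENNReal.ofReal_natCast]

theorem weightedNorm_sq (w : Space n → ℝ≥0∞) (f : Space n → ℂ) :
    weightedNorm w f ^ 2 = ∫⁻ x, ‖f x‖ₑ ^ 2 * w x := by
  rw [weightedNorm, ← ENNReal.rpow_natCast, ← ENNReal.rpow_mul]
  simp

theorem enorm_mulOp_sqrtWeight_le {V : Space n → ℂ} (hV : AEMeasurable V volume) (k : ℕ)
    (f : L2 n) : ‖mulOp _ (memLp_sqrtWeight hV k) f‖ₑ ≤ weightedNorm (absWeight V) f := by
  refine (ENNReal.pow_le_pow_left_iff two_ne_zero).1 ?_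
  rw [weightedNorm_sq, enorm_mulOp_sq]
  refine lintegral_mono fun x => ?_
  rw [enorm_sqrtWeight_sq]
  gcongr
  exact min_le_left _ _

theorem weightedNorm_mulOp_sqrtWeight_le {V : Space n → ℂ} (hV : AEMeasurable V volume) (k : ℕ)
    (f : L2 n) :
    weightedNorm (invWeight V) (mulOp _ (memLp_sqrtWeight hV k) f) ≤ ‖f‖ₑ := by
  refine (ENNReal.pow_le_pow_left_iff two_ne_zero).1 ?_
  rw [weightedNorm_sq, enorm_sq_eq_lintegral]
  refine lintegral_mono_ae ?_
  filter_upwards [coeFn_mulOp _ (memLp_sqrtWeight hV k) f] with x hx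
  rw [hx, enorm_mul, mul_pow, enorm_sqrtWeight_sq, mul_comm (min _ _), mul_assoc]
  refine mul_le_of_le_one_right' ((mul_le_mul_left (min_le_left _ _) _).trans ?_)
  exact ENNReal.mul_inv_le_one _

/-- `B` maps `L²` contractively into `L²(|V|⁻¹)`, because `min |V| k * |V|⁻¹ ≤ 1` even at zeros of
`V`. On the output side `B` is dominated by the weight `|V|`. -/
theorem norm_mulOp_freeResolvent_mulOp_le {V : Space n → ℂ} (hV : AEMeasurable V volume)
    {A : ℝ≥0} (hA : ResolventEstimate V A) (k : ℕ) (z : ℂ) (hz : z.im ≠ 0) (g : L2 n) :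
    ‖mulOp _ (memLp_sqrtWeight hV k)
      (freeResolvent z hz (mulOp _ (memLp_sqrtWeight hV k) g))‖ ≤ A * ‖g‖ := by
  have h1 := weightedNorm_mulOp_sqrtWeight_le hV k g
  have h2 := hA z hz (mulOp _ (memLp_sqrtWeight hV k) g) (h1.trans_lt enorm_lt_top)
  have h3 := (enorm_mulOp_sqrtWeight_le hV k _).trans (h2.trans (mul_le_mul_right h1 _))
  rw [← ofReal_norm, ← ofReal_norm, ← ENNReal.ofReal_coe_nnreal,
    ← ENNReal.ofReal_mul A.coe_nonneg] at h3
  exact (ENNReal.ofReal_le_ofReal_iff (by positivity)).1 h3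

theorem lintegral_absWeight_eq_iSup {V : Space n → ℂ} (hV : AEMeasurable V volume) (f : L2 n) :
    ∫⁻ x, ‖f x‖ₑ ^ 2 * absWeight V x = ⨆ k, ‖mulOp _ (memLp_sqrtWeight hV k) f‖ₑ ^ 2 := by
  simp only [enorm_mulOp_sq, enorm_sqrtWeight_sq]
  rw [← lintegral_iSup']
  · refine lintegral_congr fun x => ?_
    rw [← ENNReal.mul_iSup, ← inf_iSup_eq, ENNReal.iSup_natCast, inf_top_eq, absWeight]
  · exact fun k => ((Lp.aestronglyMeasurable f).enorm.pow_const 2).mul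
      (hV.enorm.min aemeasurable_const)
  · refine .of_forall fun x => fun i j hij => ?_
    dsimp only
    gcongr

theorem measurable_enorm_mulOp_propagator_sq (m : Space n → ℂ) (hm : MemLp m ∞ volume)
    (f : L2 n) : Measurable fun t => ‖mulOp m hm (propagator t f)‖ₑ ^ 2 := by
  have := continuous_propagator f
  refine Measurable.pow_const (Continuous.measurable ?_) 2
  exact (by fun_prop : Continuous fun t => mulOp m hm (propagator t f)).enorm

/-- The curve `t ↦ e^{itΔ} f` comes with an unrelated representative for each `t`, so Tonelli is not
at hand; measurability is read off from a supremum of continuous functions of `t`. -/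
theorem measurable_lintegral_propagator {V : Space n → ℂ} (hV : AEMeasurable V volume)
    (f : L2 n) : Measurable fun t => ∫⁻ x, ‖propagator t f x‖ₑ ^ 2 * absWeight V x := by
  simp only [lintegral_absWeight_eq_iSup hV]
  exact .iSup fun k => measurable_enorm_mulOp_propagator_sq _ _ f

theorem lintegral_propagator_le {V : Space n → ℂ} (hV : AEMeasurable V volume)
    {A : ℝ≥0} (hA : ResolventEstimate V A) (f : L2 n) :
    ∫⁻ t, ∫⁻ x, ‖propagator t f x‖ₑ ^ 2 * absWeight V x ≤ 2 * A * ‖f‖ₑ ^ 2 := by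
  simp only [lintegral_absWeight_eq_iSup hV]
  rw [lintegral_iSup fun k => measurable_enorm_mulOp_propagator_sq _ _ f]
  · refine iSup_le fun k => ?_
    have := lintegral_enorm_apply_propagator_sq_le A.coe_nonneg
      (inner_mulOp_ofReal (memLp_sqrtWeight hV k)) (norm_mulOp_freeResolvent_mulOp_le hV hA k) f
    rwa [ENNReal.ofReal_mul zero_le_two, ENNReal.ofReal_ofNat, ENNReal.ofReal_coe_nnreal] at this
  · intro i j hij t
    simp only [enorm_mulOp_sq, enorm_sqrtWeight_sq]
    gcongr

theorem spaceTimeNorm_propagator_le {V : Space n → ℂ} (hV : AEMeasurable V volume)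
    {A : ℝ≥0} (hA : ResolventEstimate V A) (f : L2 n) :
    spaceTimeNorm (absWeight V) (fun t => propagator t f) ≤
      (2 * A : ℝ≥0∞) ^ (1 / 2 : ℝ) * ‖f‖ₑ := by
  rw [spaceTimeNorm]
  calc _ ≤ (2 * A * ‖f‖ₑ ^ 2) ^ (1 / 2 : ℝ) := by gcongr; exact lintegral_propagator_le hV hA f
    _ = _ := by
      rw [ENNReal.mul_rpow_of_nonneg _ _ (by norm_num), ← ENNReal.rpow_natCast,
        ← ENNReal.rpow_mul]
      simp

/-! ### The dual estimate -/

theorem lintegral_mul_le_sqrt_mul_sqrt {α : Type*} [MeasurableSpace α] {μ : Measure α}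
    {a b : α → ℝ≥0∞} (ha : AEMeasurable a μ) (hb : AEMeasurable b μ) :
    ∫⁻ x, a x * b x ∂μ ≤
      (∫⁻ x, a x ^ 2 ∂μ) ^ (1 / 2 : ℝ) * (∫⁻ x, b x ^ 2 ∂μ) ^ (1 / 2 : ℝ) := by
  simpa using ENNReal.lintegral_mul_le_Lp_mul_Lq μ Real.HolderConjugate.two_two ha hb

theorem rpow_half_sq (a : ℝ≥0∞) : (a ^ (1 / 2 : ℝ)) ^ 2 = a := by
  rw [← ENNReal.rpow_natCast, ← ENNReal.rpow_mul]
  simp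

/-- The duality of `L²(w)` and `L²(w⁻¹)`. -/
theorem lintegral_mul_le_weighted {w : Space n → ℝ≥0∞} (hw : AEMeasurable w volume)
    (hw' : ∀ x, w x ≠ ∞) {f g : Space n → ℂ} (hf : AEStronglyMeasurable f volume)
    (hg : AEStronglyMeasurable g volume) (hfin : ∫⁻ x, ‖g x‖ₑ ^ 2 * (w x)⁻¹ < ∞) :
    ∫⁻ x, ‖f x‖ₑ * ‖g x‖ₑ ≤ (∫⁻ x, ‖f x‖ₑ ^ 2 * w x) ^ (1 / 2 : ℝ) *
      (∫⁻ x, ‖g x‖ₑ ^ 2 * (w x)⁻¹) ^ (1 / 2 : ℝ) := by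
  have hm : AEMeasurable (fun x => ‖g x‖ₑ ^ 2 * (w x)⁻¹) volume :=
    (hg.enorm.pow_const 2).mul hw.inv
  calc ∫⁻ x, ‖f x‖ₑ * ‖g x‖ₑ
      ≤ ∫⁻ x, (‖f x‖ₑ * w x ^ (1 / 2 : ℝ)) * (‖g x‖ₑ * (w x)⁻¹ ^ (1 / 2 : ℝ)) := by
        refine lintegral_mono_ae ?_
        filter_upwards [ae_lt_top' hm hfin.ne] with x hx
        -- Where `w = 0` the product of the weights is not 1, but finiteness of the integral forces
        -- `g = 0` there almost everywhere.
        rcases eq_or_ne (w x) 0 with h0 | h0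
        · have : g x = 0 := by
            by_contra hgx
            have hgx' : ‖g x‖ₑ ^ 2 ≠ 0 := by simpa using hgx
            rw [h0, ENNReal.inv_zero, ENNReal.mul_top hgx'] at hx
            exact lt_irrefl _ hx
          simp [this]
        · refine le_of_eq ?_
          rw [mul_mul_mul_comm, ← ENNReal.mul_rpow_of_nonneg _ _ (by norm_num),
            ENNReal.mul_inv_cancel h0 (hw' x), ENNReal.one_rpow, mul_one]
    _ ≤ _ := by
        refine (lintegral_mul_le_sqrt_mul_sqrt (hf.enorm.mul (hw.pow_const _))
          (hg.enorm.mul (hw.inv.pow_const _))).trans_eq ?_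
        simp only [Pi.mul_apply, Pi.inv_apply, mul_pow, rpow_half_sq]

/-! ### Measurability in time of the pairing -/

theorem integral_conj_mul_eq_inner (c : L2 n) {G : Space n → ℂ} (hG : MemLp G 2 volume) :
    ∫ x, conj (c x) * G x = inner ℂ c (hG.toLp G) := by
  rw [L2.inner_def]
  refine integral_congr_ae ?_
  filter_upwards [hG.coeFn_toLp] with x hx
  rw [hx]
  exact mul_comm _ _

/-- Joint measurability of `(s, x) ↦ p s x` is not available. For simple `p` only finitely many
fixed functions of `x` occur; the general case is a limit, by continuity of the inner product. -/
theorem aemeasurable_integral_conj_mul_of_memLp {p : ℝ → L2 n} (hp : StronglyMeasurable p)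
    {G : ℝ × Space n → ℂ} (hG : StronglyMeasurable G)
    (hG2 : ∀ᵐ s : ℝ, MemLp (fun x => G (s, x)) 2 volume) :
    AEMeasurable (fun s : ℝ => ∫ x, conj (p s x) * G (s, x)) volume := by
  refine aemeasurable_of_tendsto_metrizable_ae Filter.atTop
    (f := fun j s => ∫ x, conj (hp.approx j s x) * G (s, x)) (fun j => ?_) ?_
  · refine ((hp.approx j).measurable_bind (fun c s => ∫ x, conj (c x) * G (s, x))
      fun c => ?_).aemeasurable
    refine (StronglyMeasurable.integral_prod_right'
      (f := fun q : ℝ × Space n => conj (c q.2) * G q) ?_).measurable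
    exact (Complex.continuous_conj.comp_stronglyMeasurable
      ((Lp.stronglyMeasurable c).comp_measurable measurable_snd)).mul hG
  · filter_upwards [hG2] with s hs
    simp only [integral_conj_mul_eq_inner _ hs]
    exact (hp.tendsto_approx s).inner tendsto_const_nhds

theorem memLp_indicator_of_lintegral_lt_top {v : Space n → ℝ≥0∞} (hv : Measurable v)
    {g : Space n → ℂ} (hg : StronglyMeasurable g) (hfin : ∫⁻ x, ‖g x‖ₑ ^ 2 * (v x)⁻¹ < ∞) (k : ℕ) :
    MemLp ({x | v x ≤ k}.indicator g) 2 volume := by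
  refine ⟨(hg.indicator (measurableSet_le hv measurable_const)).aestronglyMeasurable, ?_⟩
  rw [eLpNorm_lt_top_iff_lintegral_rpow_enorm_lt_top (by simp) (by simp)]
  -- The factor is `k + 1` and not `k`: for `k = 0` and `v x = 0` the product `k * (v x)⁻¹` would be
  -- `0`.
  refine lt_of_le_of_lt (b := (k + 1 : ℝ≥0∞) * ∫⁻ x, ‖g x‖ₑ ^ 2 * (v x)⁻¹) ?_
    (ENNReal.mul_lt_top (by finiteness) hfin)
  rw [← lintegral_const_mul' _ _ (by finiteness)]
  refine lintegral_mono fun x => ?_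
  by_cases hx : v x ≤ k
  · have h1 : (1 : ℝ≥0∞) ≤ (k + 1) * (v x)⁻¹ := by
      calc (1 : ℝ≥0∞) = ((k : ℝ≥0∞) + 1) * ((k : ℝ≥0∞) + 1)⁻¹ :=
            (ENNReal.mul_inv_cancel (by simp) (by finiteness)).symm
        _ ≤ _ := by
            gcongr
            exact hx.trans le_self_add
    have h2 : ({x | v x ≤ k}.indicator g) x = g x := Set.indicator_of_mem (s := {x | v x ≤ k}) hx g
    simp only [h2]
    calc _ = ‖g x‖ₑ ^ 2 * 1 := by simp
      _ ≤ ‖g x‖ₑ ^ 2 * ((k + 1) * (v x)⁻¹) := by gcongr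
      _ = _ := by ring
  · have h2 : ({x | v x ≤ k}.indicator g) x = 0 := Set.indicator_of_notMem (s := {x | v x ≤ k}) hx g
    simp [h2]

/-- `F s` need not lie in `L²`, but its restriction to a sublevel set of the weight does for almost
every `s`. These sets exhaust the space up to a null set, and dominated convergence passes to the
limit. -/
theorem aestronglyMeasurable_integral_conj_mul {p : ℝ → L2 n} (hp : StronglyMeasurable p)
    {F : ℝ → Space n → ℂ} (hF : AEStronglyMeasurable (Function.uncurry F) volume)
    {v : Space n → ℝ≥0∞} (hv : AEMeasurable v volume) (hv' : ∀ x, v x ≠ ∞)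
    (hfin : ∀ᵐ s, ∫⁻ x, ‖F s x‖ₑ ^ 2 * (v x)⁻¹ < ∞)
    (hint : ∀ᵐ s, Integrable fun x => conj (p s x) * F s x) :
    AEStronglyMeasurable (fun s => ∫ x, conj (p s x) * F s x) volume := by
  refine AEMeasurable.aestronglyMeasurable ?_
  set G := hF.mk with hG
  have hGm : StronglyMeasurable G := hF.stronglyMeasurable_mk
  have hFG : ∀ᵐ s, ∀ᵐ x, F s x = G (s, x) := Measure.ae_ae_of_ae_prod hF.ae_eq_mk
  set w := hv.mk with hw
  have hwm : Measurable w := hv.measurable_mk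
  have hS : ∀ k : ℕ, MeasurableSet {x | w x ≤ k} := fun k => measurableSet_le hwm measurable_const
  refine aemeasurable_of_tendsto_metrizable_ae Filter.atTop
    (f := fun (k : ℕ) s => ∫ x, conj (p s x) *
      ((Prod.snd ⁻¹' {x | w x ≤ k}).indicator G) (s, x)) (fun k => ?_) ?_
  · refine aemeasurable_integral_conj_mul_of_memLp hp
      (hGm.indicator (measurable_snd (hS k))) ?_
    filter_upwards [hFG, hfin] with s hs hs'
    refine memLp_indicator_of_lintegral_lt_top hwm (g := fun x => G (s, x))
      (hGm.comp_measurable measurable_prodMk_left) ?_ k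
    refine lt_of_eq_of_lt (lintegral_congr_ae ?_) hs'
    filter_upwards [hs, hv.ae_eq_mk] with x h1 h2
    rw [h1, h2]
  · filter_upwards [hFG, hint] with s hs hs'
    refine tendsto_integral_of_dominated_convergence (fun x => ‖conj (p s x) * F s x‖)
      (fun k => ?_) hs'.norm (fun k => ?_) ?_
    · exact (Complex.continuous_conj.comp_aestronglyMeasurable (Lp.aestronglyMeasurable _)).mul
        ((hGm.indicator (measurable_snd (hS k))).comp_measurable
          measurable_prodMk_left).aestronglyMeasurable
    · filter_upwards [hs] with x hx
      rw [norm_mul, norm_mul, hx]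
      gcongr
      exact norm_indicator_le_norm_self _ _
    · filter_upwards [hs, hv.ae_eq_mk] with x hx hvx
      obtain ⟨K, hK⟩ := ENNReal.exists_nat_gt (hv' x)
      refine tendsto_const_nhds.congr' ?_
      filter_upwards [Filter.eventually_ge_atTop K] with k hk
      rw [hx, Set.indicator_of_mem]
      change w x ≤ k
      rw [hw, ← hvx]
      exact hK.le.trans (by exact_mod_cast hk)

/-! ### The functional defined by `F` and its Riesz representative -/

section Dual

variable {V : Space n → ℂ} {A : ℝ≥0} {F : ℝ → Space n → ℂ}

theorem lintegral_invWeight_lt_top (h : spaceTimeNorm (invWeight V) F < ∞) :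
    ∫⁻ s, ∫⁻ x, ‖F s x‖ₑ ^ 2 * invWeight V x < ∞ := by
  rw [spaceTimeNorm] at h
  exact (ENNReal.rpow_lt_top_iff_of_pos (by norm_num)).1 h

theorem ae_aestronglyMeasurable (hF : AEStronglyMeasurable (Function.uncurry F) volume) :
    ∀ᵐ s, AEStronglyMeasurable (F s) volume := by
  filter_upwards [AEStronglyMeasurable.prodMk_left (μ := (volume : Measure ℝ))
    (ν := (volume : Measure (Space n))) hF] with s hs
  exact hs

theorem aemeasurable_lintegral_invWeight (hV : AEMeasurable V volume)
    (hF : AEStronglyMeasurable (Function.uncurry F) volume) :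
    AEMeasurable (fun s => ∫⁻ x, ‖F s x‖ₑ ^ 2 * invWeight V x) volume := by
  have h : AEMeasurable (fun q : ℝ × Space n => ‖F q.1 q.2‖ₑ ^ 2 * invWeight V q.2)
      (volume.prod volume) := by
    refine AEMeasurable.mul (AEMeasurable.pow_const (AEStronglyMeasurable.enorm hF) 2) ?_
    exact (hV.enorm.inv).comp_snd
  exact h.lintegral_prod_right'

theorem ae_lintegral_invWeight_lt_top (hV : AEMeasurable V volume)
    (hF : AEStronglyMeasurable (Function.uncurry F) volume)
    (hfin : spaceTimeNorm (invWeight V) F < ∞) :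
    ∀ᵐ s, ∫⁻ x, ‖F s x‖ₑ ^ 2 * invWeight V x < ∞ :=
  ae_lt_top' (aemeasurable_lintegral_invWeight hV hF) (lintegral_invWeight_lt_top hfin).ne

/-- Cauchy–Schwarz in `x` with weights `|V|` and `|V|⁻¹`, then in time, and finally the homogeneous
estimate. -/
theorem lintegral_propagator_mul_le (hV : AEMeasurable V volume) (hA : ResolventEstimate V A)
    (hF : AEStronglyMeasurable (Function.uncurry F) volume)
    (hfin : spaceTimeNorm (invWeight V) F < ∞) (h : L2 n) :
    ∫⁻ s, ∫⁻ x, ‖conj (propagator s h x) * F s x‖ₑ ≤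
      (2 * A : ℝ≥0∞) ^ (1 / 2 : ℝ) * spaceTimeNorm (invWeight V) F * ‖h‖ₑ := by
  calc ∫⁻ s, ∫⁻ x, ‖conj (propagator s h x) * F s x‖ₑ
      ≤ ∫⁻ s, (∫⁻ x, ‖propagator s h x‖ₑ ^ 2 * absWeight V x) ^ (1 / 2 : ℝ) *
          (∫⁻ x, ‖F s x‖ₑ ^ 2 * invWeight V x) ^ (1 / 2 : ℝ) := by
        refine lintegral_mono_ae ?_
        filter_upwards [ae_lintegral_invWeight_lt_top hV hF hfin, ae_aestronglyMeasurable hF]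
          with s h1 h2
        simp only [enorm_mul, RCLike.enorm_conj]
        exact lintegral_mul_le_weighted hV.enorm (fun x => enorm_ne_top)
          (Lp.aestronglyMeasurable _) h2 h1
    _ ≤ spaceTimeNorm (absWeight V) (fun s => propagator s h) *
          spaceTimeNorm (invWeight V) F := by
        refine (lintegral_mul_le_sqrt_mul_sqrt
          ((measurable_lintegral_propagator hV h).pow_const _).aemeasurable
          ((aemeasurable_lintegral_invWeight hV hF).pow_const _)).trans_eq ?_
        simp only [rpow_half_sq, spaceTimeNorm]
    _ ≤ _ := by
        rw [mul_right_comm]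
        gcongr
        exact spaceTimeNorm_propagator_le hV hA h

theorem lintegral_propagator_mul_lt_top (hV : AEMeasurable V volume) (hA : ResolventEstimate V A)
    (hF : AEStronglyMeasurable (Function.uncurry F) volume)
    (hfin : spaceTimeNorm (invWeight V) F < ∞) (h : L2 n) :
    ∫⁻ s, ∫⁻ x, ‖conj (propagator s h x) * F s x‖ₑ < ∞ :=
  (lintegral_propagator_mul_le hV hA hF hfin h).trans_lt
    (ENNReal.mul_lt_top (ENNReal.mul_lt_top
      (ENNReal.rpow_lt_top_of_nonneg (by norm_num) (by finiteness)) hfin) enorm_lt_top)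

theorem ae_integrable_propagator_mul (hV : AEMeasurable V volume)
    (hA : ResolventEstimate V A) (hF : AEStronglyMeasurable (Function.uncurry F) volume)
    (hfin : spaceTimeNorm (invWeight V) F < ∞) (h : L2 n) :
    ∀ᵐ s, Integrable fun x => conj (propagator s h x) * F s x := by
  have h1 : ∀ᵐ s, (∫⁻ x, ‖propagator s h x‖ₑ ^ 2 * absWeight V x) < ∞ :=
    ae_lt_top (measurable_lintegral_propagator hV h)
      ((lintegral_propagator_le hV hA h).trans_lt (by finiteness)).ne
  filter_upwards [h1, ae_lintegral_invWeight_lt_top hV hF hfin, ae_aestronglyMeasurable hF]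
    with s h1 h2 h3
  refine ⟨(Complex.continuous_conj.comp_aestronglyMeasurable (Lp.aestronglyMeasurable _)).mul h3,
    ?_⟩
  rw [hasFiniteIntegral_iff_enorm]
  simp only [enorm_mul, RCLike.enorm_conj]
  refine (lintegral_mul_le_weighted hV.enorm (fun x => enorm_ne_top)
    (Lp.aestronglyMeasurable _) h3 h2).trans_lt (ENNReal.mul_lt_top ?_ ?_)
  · exact ENNReal.rpow_lt_top_of_nonneg (by norm_num) h1.ne
  · exact ENNReal.rpow_lt_top_of_nonneg (by norm_num) h2.ne

theorem integrable_integral_propagator_mul (hV : AEMeasurable V volume)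
    (hA : ResolventEstimate V A) (hF : AEStronglyMeasurable (Function.uncurry F) volume)
    (hfin : spaceTimeNorm (invWeight V) F < ∞) (h : L2 n) :
    Integrable fun s => ∫ x, conj (propagator s h x) * F s x := by
  refine ⟨aestronglyMeasurable_integral_conj_mul (continuous_propagator h).stronglyMeasurable hF
    hV.enorm (fun x => enorm_ne_top) (ae_lintegral_invWeight_lt_top hV hF hfin)
    (ae_integrable_propagator_mul hV hA hF hfin h), ?_⟩
  rw [hasFiniteIntegral_iff_enorm]
  exact (lintegral_mono fun s => enorm_integral_le_lintegral_enorm _).trans_lt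
    (lintegral_propagator_mul_lt_top hV hA hF hfin h)

/-- The adjoint of `f ↦ e^{itΔ} f`, by the Riesz representation theorem. -/
theorem exists_inner_eq_integral_propagator (hV : AEMeasurable V volume)
    (hA : ResolventEstimate V A) (hF : AEStronglyMeasurable (Function.uncurry F) volume)
    (hfin : spaceTimeNorm (invWeight V) F < ∞) :
    ∃ g : L2 n, (∀ h : L2 n, inner ℂ h g = ∫ s, ∫ x, conj (propagator s h x) * F s x) ∧
      ‖g‖ₑ ≤ (2 * A : ℝ≥0∞) ^ (1 / 2 : ℝ) * spaceTimeNorm (invWeight V) F := by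
  set K : ℝ≥0∞ := (2 * A : ℝ≥0∞) ^ (1 / 2 : ℝ) * spaceTimeNorm (invWeight V) F with hK
  have hKtop : K ≠ ∞ := (ENNReal.mul_lt_top
    (ENNReal.rpow_lt_top_of_nonneg (by norm_num) (by finiteness)) hfin).ne
  set I : L2 n → ℂ := fun h => ∫ s, ∫ x, conj (propagator s h x) * F s x with hI
  have hint := ae_integrable_propagator_mul hV hA hF hfin
  have hadd : ∀ h h', I (h + h') = I h + I h' := fun h h' => by
    rw [hI, ← integral_add (integrable_integral_propagator_mul hV hA hF hfin h)
      (integrable_integral_propagator_mul hV hA hF hfin h')]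
    refine integral_congr_ae ?_
    filter_upwards [hint h, hint h'] with s h1 h2
    rw [← integral_add h1 h2]
    refine integral_congr_ae ?_
    have e : propagator s (h + h') = propagator s h + propagator s h' :=
      (fourierMultiplierL _ (memLp_propagatorSymbol s)).map_add h h'
    filter_upwards [Lp.coeFn_add (propagator s h) (propagator s h')] with x hx
    rw [e, hx, Pi.add_apply, map_add, add_mul]
  have hsmul : ∀ (c : ℂ) h, I (c • h) = conj c * I h := fun c h => by
    rw [hI, ← integral_const_mul]
    refine integral_congr_ae (.of_forall fun s => ?_)
    dsimp only
    rw [← integral_const_mul]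
    refine integral_congr_ae ?_
    have e : propagator s (c • h) = c • propagator s h :=
      (fourierMultiplierL _ (memLp_propagatorSymbol s)).map_smul c h
    filter_upwards [Lp.coeFn_smul c (propagator s h)] with x hx
    rw [e, hx, Pi.smul_apply, smul_eq_mul, map_mul, mul_assoc]
  have hbound : ∀ h, ‖I h‖ ≤ K.toReal * ‖h‖ := fun h => by
    have h1 : ‖I h‖ₑ ≤ K * ‖h‖ₑ :=
      (enorm_integral_le_lintegral_enorm _).trans
        ((lintegral_mono fun s => enorm_integral_le_lintegral_enorm _).trans
          (lintegral_propagator_mul_le hV hA hF hfin h))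
    have h2 := ENNReal.toReal_mono (by finiteness) h1
    simpa using h2
  -- `I` is conjugate-linear in `h`, so the Riesz theorem is applied to its conjugate.
  set L : L2 n →L[ℂ] ℂ := LinearMap.mkContinuous
    { toFun := fun h => conj (I h)
      map_add' := fun h h' => by rw [hadd, map_add]
      map_smul' := fun c h => by simp [hsmul] } K.toReal fun h => by
        simpa using hbound h with hL
  refine ⟨(InnerProductSpace.toDual ℂ (L2 n)).symm L, fun h => ?_, ?_⟩
  · rw [← inner_conj_symm, InnerProductSpace.toDual_symm_apply]
    change conj (conj (I h)) = I h
    exact Complex.conj_conj _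
  · rw [← ofReal_norm, LinearIsometryEquiv.norm_map]
    exact ENNReal.ofReal_le_of_le_toReal
      (LinearMap.mkContinuous_norm_le _ ENNReal.toReal_nonneg _)

end Dual

end WeightedSchrodinger

end

theorem mainTheorem9 (n : ℕ) (hn : 2 ≤ n) :
    ∃ C : ℝ≥0, ∀ (V : Space n → ℂ) (A : ℝ≥0), AEMeasurable V volume → ResolventEstimate V A →
      (∀ f : L2 n,
        spaceTimeNorm (absWeight V) (fun t => propagator t f) ≤
          C * (A : ℝ≥0∞) ^ (1 / 2 : ℝ) * ‖f‖ₑ) ∧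
      (∀ F : ℝ → Space n → ℂ, AEStronglyMeasurable (Function.uncurry F) volume →
        spaceTimeNorm (invWeight V) F < ∞ →
        ∃ U : ℝ → L2 n, (∀ t, IsPropagatorIntegral F t (U t)) ∧
          spaceTimeNorm (absWeight V) (fun t => U t) ≤
            C * A * spaceTimeNorm (invWeight V) F) := by
  -- The second estimate produces exactly `2A`; the first needs only `√2 ≤ 2`.
  refine ⟨2, fun V A hV hA => ⟨fun f => ?_, fun F hF hfin => ?_⟩⟩
  · refine (spaceTimeNorm_propagator_le hV hA f).trans ?_
    rw [ENNReal.mul_rpow_of_nonneg _ _ (by norm_num)]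
    gcongr
    calc (2 : ℝ≥0∞) ^ (1 / 2 : ℝ) ≤ 2 ^ (1 : ℝ) :=
          ENNReal.rpow_le_rpow_of_exponent_le (by norm_num) (by norm_num)
      _ = _ := by simp
  · obtain ⟨g, hg, hgn⟩ := exists_inner_eq_integral_propagator hV hA hF hfin
    -- `g` is the weak integral at time `0`; the group law and the adjoint relation carry it to time
    -- `t`.
    refine ⟨fun t => propagator t g, fun t h => ?_, ?_⟩
    · have e : ∀ s, propagator (s - t) h = propagator s (propagator (-t) h) := fun s => by
        rw [propagator_propagator, sub_eq_add_neg]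
      simp only [e]
      refine ⟨ae_integrable_propagator_mul hV hA hF hfin _,
        integrable_integral_propagator_mul hV hA hF hfin _, ?_⟩
      rw [← inner_propagator_left, hg]
    · refine (spaceTimeNorm_propagator_le hV hA g).trans ((mul_le_mul_right hgn _).trans_eq ?_)
      rw [← mul_assoc, ← sq, rpow_half_sq]
      rfl
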